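/- Let $\|x\|$ denote the distance from the real number $x$ to the nearest integer and, for real $\varepsilon>0$ and $c>0$, put $$ S(\varepsilon,c)=\Bigl\{\varepsilon'\in(\varepsilon,2\varepsilon)\ :\ \inf_{n\ge 1}\bigl\|(1+\varepsilon')^n\bigr\|>c\,\varepsilon\,|\log\varepsilon|^{-1}\Bigr\}. $$ Then, for every sufficiently small $\varepsilon>0$, the Hausdorff dimension of $S(\varepsilon,c)$ tends to $1$ as $c$ tends to $0$ from the right. That is, there is $\varepsilon_0>0$ such that $\lim_{c\to0^+}\dim_H S(\varepsilon,c)=1$ for every $\varepsilon\in(0,\varepsilon_0)$. Moreover, the constant $c$ can be chosen independently of $\varepsilon$: for every $\delta>0$ there are $c_0>0$ and $\varepsilon_1>0$, depending only on $\delta$, such that $\dim_H S(\varepsilon,c)\ge 1-\delta$ for all $\varepsilon\in(0,\varepsilon_1)$ and all $c\in(0,c_0)$. -/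

import Mathlib

open Set Filter Topology

/-- The distance from a real number to the nearest integer. -/
noncomputable def distNearestInt (x : ℝ) : ℝ := |x - round x|

/-- `distNearestInt x` is indeed the least of the distances from `x` to the integers. -/
theorem isLeast_distNearestInt (x : ℝ) :
    IsLeast (range fun m : ℤ => |x - m|) (distNearestInt x) :=
  ⟨⟨round x, rfl⟩, by rintro _ ⟨m, rfl⟩; exact round_le x m⟩

/-- The set of all `ε'` in `(ε, 2ε)` such that the infimum over `n ≥ 1` of the distance of
`(1 + ε') ^ n` to the nearest integer exceeds `c ε |log ε|⁻¹`. -/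
noncomputable def awayFromIntegersSet (ε c : ℝ) : Set ℝ :=
  {ε' | ε' ∈ Ioo ε (2 * ε) ∧
    c * ε * |Real.log ε|⁻¹ < ⨅ n : {n : ℕ // 1 ≤ n}, distNearestInt ((1 + ε') ^ (n : ℕ))}

/-! Write `x = 1 + ε'`. The point `x` is bad when `|x ^ n - m| < η` for some `n ≥ 1`, `m ≥ 2`, with
`η` slightly larger than `c ε / |log ε|`; it then lies within `4η / (nm)` of the `n`-th root of `m`.
A Cantor set of good points is built inside `[1 + 5ε/4, 1 + 7ε/4]`, with ratio `R = ρ ^ 2`, `ρ = 2M`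
of order `1 / (cε)`, and the pairs `(n, m)` are sorted into windows by the size of `nm`.

The main estimate concerns an interval of length `ℓ` and the next window. For one `n`, the roots
have spacing about `1 / (nm) = O(ℓ)`, so their neighbourhoods cover `O(ηℓ)`. Since `m` is about `x ^
n` with `log x` of order `ε`, fixing `nm` up to a factor `ρ ^ 2` leaves `O(log ρ / ε)` exponents.
The bad proportion is thus `O(η log ρ / ε)`, plus `O(log ρ / ρ)` from enlarging the neighbourhoods.
As `log ρ = O_c(|log ε|)`, the factor `|log ε|⁻¹` in `η` makes this `O(√c)`, uniformly in `ε`.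

At least `M ^ 2` of the `4M ^ 2` subintervals therefore survive each step, and the dimension is at
least `log (M ^ 2) / log (4M ^ 2)`. This tends to `1` as `c → 0` because `2M ≥ 1 / c`. -/

/-! ### Dimension of nested Cantor sets -/

/-- If every interval of length `ℓ / R ^ k` admissible at level `k` has at least `N` admissible
subintervals of length `ℓ / R ^ (k + 1)` placed at even multiples of that length, then the points
lying in admissible intervals of every level form a set of dimension at least `log N / log R`. -/
theorem log_div_log_le_dimH_of_nested {N R : ℕ} (hN : 2 ≤ N) {ℓ : ℝ} (hℓ : 0 < ℓ)
    (P : ℕ → ℝ → Prop) {a₀ : ℝ} (h₀ : P 0 a₀)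
    (hP : ∀ k a, P k a → ∃ s : Finset ℕ, N ≤ s.card ∧
      ∀ i ∈ s, 2 * i + 2 ≤ R ∧ P (k + 1) (a + 2 * i * (ℓ / R ^ (k + 1)))) :
    ENNReal.ofReal (Real.log N / Real.log R) ≤
      dimH {x | ∀ k, ∃ a, P k a ∧ x ∈ Icc a (a + ℓ / R ^ k)} := by
  have hstep : ∀ k a, ∃ f : Fin N → ℕ, P k a → Function.Injective f ∧
      ∀ j, 2 * f j + 2 ≤ R ∧ P (k + 1) (a + 2 * f j * (ℓ / R ^ (k + 1))) := by
    intro k a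
    by_cases h : P k a
    · obtain ⟨s, hs, hs'⟩ := hP k a h
      obtain ⟨t, hts, ht⟩ := Finset.exists_subset_card_eq hs
      refine ⟨fun j => t.orderEmbOfFin ht j, fun _ => ⟨fun i j hij => ?_, fun j => ?_⟩⟩
      · exact (t.orderEmbOfFin ht).injective hij
      · exact hs' _ (hts (t.orderEmbOfFin_mem ht j))
    · exact ⟨fun _ => 0, fun h' => absurd h' h⟩
  choose f hf using hstep
  have hNR : 2 * N ≤ R := by
    obtain ⟨hinj, hb⟩ := hf 0 a₀ h₀
    have : Fintype.card (Fin N) ≤ (Finset.range (R / 2)).card := by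
      rw [← Finset.card_univ]
      refine Finset.card_le_card_of_injOn (f 0 a₀) (fun j _ => ?_) hinj.injOn
      have := (hb j).1
      simp only [Finset.coe_range, mem_Iio]
      omega
    simp at this
    omega
  have hR : (0 : ℝ) < R := by
    have : 0 < R := by omega
    exact_mod_cast this
  have hR1 : (1 : ℝ) < R := by
    have : 1 < R := by omega
    exact_mod_cast this
  have hN1 : (1 : ℝ) < N := by exact_mod_cast (show 1 < N by omega)
  let left : (ℕ → Fin N) → ℕ → ℝ := fun d k =>
    Nat.rec a₀ (fun k a => a + 2 * f k a (d k) * (ℓ / R ^ (k + 1))) k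
  have hleft : ∀ d k, left d (k + 1) =
      left d k + 2 * f k (left d k) (d k) * (ℓ / R ^ (k + 1)) := fun d k => rfl
  have hPl : ∀ d k, P k (left d k) := by
    intro d k
    induction k with
    | zero => exact h₀
    | succ k ih => rw [hleft]; exact ((hf k _ ih).2 (d k)).2
  have hmono : ∀ d, Monotone (left d) := by
    intro d
    refine monotone_nat_of_le_succ fun k => ?_
    rw [hleft]
    have : 0 ≤ 2 * (f k (left d k) (d k) : ℝ) * (ℓ / R ^ (k + 1)) := by positivity
    linarith
  have hanti : ∀ d, Antitone fun k => left d k + ℓ / R ^ k := by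
    intro d
    refine antitone_nat_of_succ_le fun k => ?_
    have h1 : (2 * f k (left d k) (d k) + 2 : ℝ) ≤ R := by
      exact_mod_cast ((hf k _ (hPl d k)).2 (d k)).1
    have h2 : ℓ / R ^ k = R * (ℓ / R ^ (k + 1)) := by field_simp; ring
    have h3 : 0 < ℓ / (R : ℝ) ^ (k + 1) := by positivity
    rw [hleft, h2]
    nlinarith
  have hle : ∀ d j k, left d j ≤ left d k + ℓ / R ^ k := by
    intro d j k
    have hp : 0 < ℓ / (R : ℝ) ^ (max j k) := by positivity
    have h1 := hmono d (le_max_left j k)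
    have h2 := hanti d (le_max_right j k)
    simp only at h2
    linarith
  let g : (ℕ → Fin N) → ℝ := fun d => ⨆ k, left d k
  have hbdd : ∀ d, BddAbove (range (left d)) := fun d =>
    ⟨_, by rintro _ ⟨j, rfl⟩; exact hle d j 0⟩
  have hg : ∀ d k, g d ∈ Icc (left d k) (left d k + ℓ / R ^ k) := fun d k =>
    ⟨le_ciSup (hbdd d) k, ciSup_le fun j => hle d j k⟩
  have hagree : ∀ d e k, (∀ i < k, d i = e i) → left d k = left e k := by
    intro d e k
    induction k with
    | zero => exact fun _ => rfl
    | succ k ih =>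
      intro h
      rw [hleft, hleft, ih fun i hi => h i (by omega), h k (by omega)]
  -- Even positions leave a gap of at least one full length between siblings.
  have hsep : ∀ d e k, (∀ i < k, d i = e i) → d k ≠ e k →
      ℓ / R ^ (k + 1) ≤ |g d - g e| := by
    intro d e k h hk
    have heq := hagree d e k h
    have hne : f k (left e k) (d k) ≠ f k (left e k) (e k) := fun h' =>
      hk ((hf k _ (hPl e k)).1 h')
    have hd := hg d (k + 1)
    have he := hg e (k + 1)
    have hp : 0 < ℓ / (R : ℝ) ^ (k + 1) := by positivity
    rw [hleft, heq] at hd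
    rw [hleft] at he
    rcases lt_or_gt_of_ne hne with h' | h'
    · have : (f k (left e k) (d k) : ℝ) + 1 ≤ f k (left e k) (e k) := by exact_mod_cast h'
      rw [abs_sub_comm]
      refine le_trans ?_ (le_abs_self _)
      have := mul_le_mul_of_nonneg_right this hp.le
      linarith [hd.2, he.1]
    · have : (f k (left e k) (e k) : ℝ) + 1 ≤ f k (left e k) (d k) := by exact_mod_cast h'
      refine le_trans ?_ (le_abs_self _)
      have := mul_le_mul_of_nonneg_right this hp.le
      linarith [he.2, hd.1]
  have hfirst : ∀ d e : ℕ → Fin N, d ≠ e → ∃ k, (∀ i < k, d i = e i) ∧ d k ≠ e k := by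
    intro d e hde
    have hex : ∃ k, d k ≠ e k := Function.ne_iff.1 hde
    classical
    exact ⟨Nat.find hex, fun i hi => not_not.1 (Nat.find_min hex hi), Nat.find_spec hex⟩
  have hginj : Function.Injective g := by
    intro d e hde
    by_contra hne
    obtain ⟨k, hk, hk'⟩ := hfirst d e hne
    have := hsep d e k hk hk'
    rw [hde, sub_self, abs_zero] at this
    have hp : 0 < ℓ / (R : ℝ) ^ (k + 1) := by positivity
    linarith
  set α : ℝ := Real.log N / Real.log R with hα
  have hlR : 0 < Real.log R := Real.log_pos hR1
  have hαpos : 0 < α := div_pos (Real.log_pos hN1) hlR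
  have hRα : (R : ℝ) ^ α = N := by
    rw [Real.rpow_def_of_pos hR, hα, mul_div_cancel₀ _ hlR.ne', Real.exp_log (by linarith)]
  have hne : Nonempty (Fin N) := ⟨⟨0, by omega⟩⟩
  -- Reading digits in base `N` is Hölder of exponent `α` because `R ^ α = N`. It maps the Cantor
  -- set onto a set containing `[0, 1]`, which forces dimension at least `α`.
  have hholder : ∀ d e : ℕ → Fin N, |Real.ofDigits d - Real.ofDigits e| ≤
      (R / ℓ) ^ α * |g d - g e| ^ α := by
    intro d e
    by_cases hde : d = e
    · subst hde
      simp [Real.zero_rpow hαpos.ne']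
    obtain ⟨k, hk, hk'⟩ := hfirst d e hde
    refine (Real.abs_ofDigits_sub_ofDigits_le hk).trans ?_
    have h1 : ((N : ℝ) ^ k)⁻¹ = (R / ℓ) ^ α * (ℓ / R ^ (k + 1)) ^ α := by
      rw [← Real.mul_rpow (by positivity) (by positivity)]
      have : (R / ℓ * (ℓ / R ^ (k + 1)) : ℝ) = ((R : ℝ) ^ k)⁻¹ := by field_simp; ring
      rw [this, Real.inv_rpow (by positivity), ← Real.rpow_natCast (R : ℝ) k, ← Real.rpow_mul hR.le,
        mul_comm, Real.rpow_mul hR.le, hRα, Real.rpow_natCast]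
    rw [h1]
    gcongr
    exact hsep d e k hk hk'
  let F : ℝ → ℝ := fun x => Real.ofDigits (Function.invFun g x)
  have hF : ∀ d, F (g d) = Real.ofDigits d := fun d => by
    simp only [F, Function.leftInverse_invFun hginj d]
  have hH : HolderOnWith (Real.toNNReal ((R / ℓ) ^ α)) (Real.toNNReal α) F (range g) := by
    rintro _ ⟨d, rfl⟩ _ ⟨e, rfl⟩
    rw [hF, hF, edist_dist, edist_dist, Real.dist_eq, Real.dist_eq, Real.coe_toNNReal _ hαpos.le,
      ENNReal.ofReal_rpow_of_nonneg (abs_nonneg _) hαpos.le]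
    change _ ≤ ENNReal.ofReal _ * _
    rw [← ENNReal.ofReal_mul (by positivity)]
    exact ENNReal.ofReal_le_ofReal (hholder d e)
  have hdim := hH.dimH_image_le (Real.toNNReal_pos.2 hαpos)
  have himg : Icc (0 : ℝ) 1 ⊆ F '' range g := by
    intro y hy
    obtain ⟨d, -, hd⟩ := Real.ofDigits_SurjOn (b := N) (by omega) hy
    exact ⟨g d, ⟨d, rfl⟩, by rw [hF, hd]⟩
  have h1 : (1 : ENNReal) ≤ dimH (range g) / (Real.toNNReal α : ENNReal) := by
    refine le_trans ?_ ((dimH_mono himg).trans hdim)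
    rw [Real.dimH_of_nonempty_interior (by simp)]
    simp
  rw [ENNReal.le_div_iff_mul_le (Or.inl (by simpa using hαpos)) (Or.inl (by simp)), one_mul] at h1
  refine le_trans h1 (dimH_mono ?_)
  rintro _ ⟨d, rfl⟩ k
  exact ⟨left d k, hPl d k, hg d k⟩

/-! ### Selecting subintervals by measure -/

open MeasureTheory in
theorem card_mul_le_volume_inter {R : ℕ} {a h t : ℝ} (hh : 0 < h) (U : Set ℝ) (s : Finset ℕ)
    (hs : ∀ i ∈ s, 2 * i + 1 ≤ R)
    (ht : ∀ i ∈ s, ENNReal.ofReal t ≤ volume (Icc (a + 2 * i * h) (a + 2 * i * h + h) ∩ U)) :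
    s.card * ENNReal.ofReal t ≤ volume (Icc a (a + R * h) ∩ U) := by
  have hsub : (⋃ i ∈ s, Icc (a + 2 * i * h) (a + 2 * i * h + h)) ⊆ Icc a (a + R * h) := by
    intro x hx
    simp only [mem_iUnion] at hx
    obtain ⟨i, hi, h1, h2⟩ := hx
    have h3 : (2 * i + 1 : ℝ) ≤ R := by exact_mod_cast hs i hi
    have h4 := mul_le_mul_of_nonneg_right h3 hh.le
    have h5 : 0 ≤ 2 * (i : ℝ) * h := by positivity
    constructor <;> linarith
  have hdisj : (s : Set ℕ).PairwiseDisjoint fun i : ℕ =>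
      Icc (a + 2 * i * h) (a + 2 * i * h + h) := by
    have key : ∀ i j : ℕ, i < j → Disjoint (Icc (a + 2 * i * h) (a + 2 * i * h + h))
        (Icc (a + 2 * j * h) (a + 2 * j * h + h)) := by
      intro i j hij
      rw [Set.disjoint_left]
      rintro x ⟨-, h1⟩ ⟨h2, -⟩
      have h3 : (i + 1 : ℝ) ≤ j := by exact_mod_cast hij
      have h4 := mul_le_mul_of_nonneg_right h3 hh.le
      linarith
    intro i _ j _ hij
    rcases lt_or_gt_of_ne hij with h' | h'
    · exact key i j h'
    · exact (key j i h').symm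
  rw [← Measure.restrict_apply measurableSet_Icc]
  refine le_trans ?_ (measure_mono hsub)
  rw [measure_biUnion_finset hdisj fun _ _ => measurableSet_Icc, ← nsmul_eq_mul,
    ← Finset.sum_const]
  refine Finset.sum_le_sum fun i hi => ?_
  rw [Measure.restrict_apply measurableSet_Icc]
  exact ht i hi

open MeasureTheory in
/-- An interval of which `U` and `V` cover small proportions has many subintervals, of `4 * N`
times smaller length, which are not contained in `U` and of which `V` covers a small proportion. -/
theorem exists_finset_not_subset_and_volume_le {N : ℕ} (hN : 0 < N) {a h : ℝ} (hh : 0 < h)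
    {U V : Set ℝ}
    (hU : volume (Icc a (a + (4 * N : ℕ) * h) ∩ U) ≤ ENNReal.ofReal ((4 * N : ℕ) * h / 8))
    (hV : volume (Icc a (a + (4 * N : ℕ) * h) ∩ V) ≤ ENNReal.ofReal ((4 * N : ℕ) * h / 64)) :
    ∃ s : Finset ℕ, N ≤ s.card ∧ ∀ i ∈ s, 2 * i + 2 ≤ 4 * N ∧
      ¬ Icc (a + 2 * i * h) (a + 2 * i * h + h) ⊆ U ∧
      volume (Icc (a + 2 * i * h) (a + 2 * i * h + h) ∩ V) ≤ ENNReal.ofReal (h / 8) := by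
  classical
  set A := (Finset.range (2 * N)).filter fun i : ℕ =>
    Icc (a + 2 * i * h) (a + 2 * i * h + h) ⊆ U with hA
  set B := (Finset.range (2 * N)).filter fun i : ℕ =>
    ENNReal.ofReal (h / 8) < volume (Icc (a + 2 * i * h) (a + 2 * i * h + h) ∩ V) with hB
  have hbound : ∀ (s : Finset ℕ) (t M : ℝ), 0 < t →
      s.card * ENNReal.ofReal t ≤ ENNReal.ofReal M → 0 ≤ M → s.card * t ≤ M := by
    intro s t M ht hst hM
    rw [← ENNReal.ofReal_natCast, ← ENNReal.ofReal_mul (by positivity)] at hst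
    exact (ENNReal.ofReal_le_ofReal_iff hM).1 hst
  have hAc : (A.card : ℝ) * h ≤ (4 * N : ℕ) * h / 8 := by
    refine hbound A h _ hh ((card_mul_le_volume_inter hh U A ?_ ?_).trans hU) (by positivity)
    · intro i hi
      simp only [hA, Finset.mem_filter, Finset.mem_range] at hi
      omega
    · intro i hi
      simp only [hA, Finset.mem_filter, Finset.mem_range] at hi
      rw [inter_eq_left.2 hi.2, Real.volume_Icc, add_sub_cancel_left]
  have hBc : (B.card : ℝ) * (h / 8) ≤ (4 * N : ℕ) * h / 64 := by
    refine hbound B (h / 8) _ (by positivity)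
      ((card_mul_le_volume_inter hh V B ?_ ?_).trans hV) (by positivity)
    · intro i hi
      simp only [hB, Finset.mem_filter, Finset.mem_range] at hi
      omega
    · intro i hi
      simp only [hB, Finset.mem_filter, Finset.mem_range] at hi
      exact hi.2.le
  have hA2 : 2 * A.card ≤ N := by
    push_cast at hAc
    have : (2 * A.card : ℝ) ≤ N := le_of_mul_le_mul_right (by linarith) hh
    exact_mod_cast this
  have hB2 : 2 * B.card ≤ N := by
    push_cast at hBc
    have : (2 * B.card : ℝ) ≤ N := le_of_mul_le_mul_right (by linarith) hh
    exact_mod_cast this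
  -- Of the `2N` even positions, `A` and `B` each remove at most `N / 2`.
  refine ⟨(Finset.range (2 * N) \ A) \ B, ?_, fun i hi => ?_⟩
  · have h1 := Finset.le_card_sdiff A (Finset.range (2 * N))
    have h2 := Finset.le_card_sdiff B (Finset.range (2 * N) \ A)
    rw [Finset.card_range] at h1
    omega
  · simp only [hA, hB, Finset.mem_sdiff, Finset.mem_filter, Finset.mem_range, not_and,
      not_lt] at hi
    exact ⟨by omega, hi.1.2 hi.1.1, hi.2 hi.1.1⟩

/-! ### Roots of integers in short intervals -/

/-- The positive `n`-th root of `m`. -/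
noncomputable def natRoot (n m : ℕ) : ℝ := Real.exp (Real.log m / n)

theorem log_natRoot (n m : ℕ) : Real.log (natRoot n m) = Real.log m / n := Real.log_exp _

theorem natRoot_pos (n m : ℕ) : 0 < natRoot n m := Real.exp_pos _

theorem natRoot_pow {n m : ℕ} (hn : 1 ≤ n) (hm : 1 ≤ m) : natRoot n m ^ n = m := by
  have h : (n : ℝ) ≠ 0 := by positivity
  rw [natRoot, ← Real.exp_nat_mul, mul_div_cancel₀ _ h, Real.exp_log (by exact_mod_cast hm)]

/-- Compare both sides with `n log (v / u)`, using `1 - 1/t ≤ log t ≤ t - 1`. -/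
theorem mul_sub_le_pow_sub_pow {n : ℕ} {c u v : ℝ} (hu : 0 < u) (huv : u ≤ v) (hv : v ≤ 2)
    (hcu : c ≤ u ^ n) : n * (v - u) * c ≤ 2 * (v ^ n - u ^ n) := by
  have hv0 : 0 < v := hu.trans_le huv
  have h1 : 1 - (v / u)⁻¹ ≤ Real.log (v / u) := Real.one_sub_inv_le_log_of_pos (by positivity)
  have h2 : Real.log (v ^ n / u ^ n) ≤ v ^ n / u ^ n - 1 :=
    Real.log_le_sub_one_of_pos (by positivity)
  rw [← div_pow, Real.log_pow, div_pow] at h2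
  have h3 : (v - u) / 2 ≤ 1 - (v / u)⁻¹ := by
    rw [inv_div, ← div_self hv0.ne', ← sub_div]
    exact div_le_div_of_nonneg_left (by linarith) hv0 hv
  have h4 : n * ((v - u) / 2) ≤ (v ^ n - u ^ n) / u ^ n := by
    rw [sub_div (v ^ n), div_self (show u ^ n ≠ 0 by positivity)]
    exact (mul_le_mul_of_nonneg_left (h3.trans h1) n.cast_nonneg).trans h2
  rw [le_div_iff₀ (by positivity)] at h4
  have h5 : n * ((v - u) / 2) * c ≤ n * ((v - u) / 2) * u ^ n :=
    mul_le_mul_of_nonneg_left hcu (mul_nonneg n.cast_nonneg (by linarith))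
  linarith

theorem abs_sub_natRoot_le {n m : ℕ} {x η : ℝ} (hn : 1 ≤ n) (hm : 2 ≤ m) (hx1 : 1 ≤ x)
    (hx2 : x ≤ 3 / 2) (hη : η ≤ 1 / 2) (h : |x ^ n - m| < η) :
    |x - natRoot n m| ≤ 4 * η / (n * m) := by
  have hn0 : (0 : ℝ) < n := by positivity
  have hm2 : (2 : ℝ) ≤ m := by exact_mod_cast hm
  have hp := natRoot_pow hn (show 1 ≤ m by omega)
  have hp0 := natRoot_pos n m
  set p := natRoot n m
  obtain ⟨h1, h2⟩ := abs_lt.1 h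
  rw [le_div_iff₀ (by positivity)]
  rcases le_total x p with hxp | hxp
  -- If `p > 2`, then `m / x ^ n ≥ p / x ≥ 4/3`, which with `x ^ n > m - 1/2` gives `m < 2`.
  · have hpx : p ≤ 2 := by
      by_contra! hlt
      have h3 : (4 / 3 : ℝ) ≤ p / x := by
        rw [le_div_iff₀ (by linarith)]
        linarith
      have h4 : p / x ≤ (p / x) ^ n := le_self_pow₀ (by linarith) (by omega)
      rw [div_pow, hp] at h4
      have h5 := h3.trans h4
      rw [le_div_iff₀ (by positivity)] at h5
      linarith
    have := mul_sub_le_pow_sub_pow (n := n) (c := m / 2) (by linarith) hxp hpx (by linarith)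
    rw [hp] at this
    rw [abs_sub_comm, abs_of_nonneg (by linarith)]
    nlinarith
  · have := mul_sub_le_pow_sub_pow (n := n) (c := m / 2) hp0 hxp (by linarith) (by linarith)
    rw [hp] at this
    rw [abs_of_nonneg (by linarith)]
    nlinarith

theorem sum_Icc_inv_le {a b : ℕ} (ha : 1 ≤ a) (hab : a ≤ b) :
    ∑ m ∈ Finset.Icc a b, (1 : ℝ) / m ≤ 1 / a + (Real.log b - Real.log a) := by
  induction b, hab using Nat.le_induction with
  | base => simp
  | succ b hb ih =>
    rw [← Finset.insert_Icc_right_eq_Icc_add_one (by omega), Finset.sum_insert (by simp)]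
    have hb0 : (0 : ℝ) < b := by
      have : 0 < b := by omega
      exact_mod_cast this
    have h1 := Real.one_sub_inv_le_log_of_pos (show (0 : ℝ) < (b + 1) / b by positivity)
    rw [Real.log_div (by positivity) hb0.ne', inv_div] at h1
    have h2 : (1 : ℝ) / (b + 1) = 1 - b / (b + 1) := by field_simp; ring
    push_cast
    linarith

theorem log_sub_log_le_of_natRoot_mem {n a b : ℕ} {u w : ℝ} (hn : 1 ≤ n) (hu : 1 ≤ u)
    (ha : natRoot n a ∈ Icc u (u + w)) (hb : natRoot n b ∈ Icc u (u + w)) :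
    Real.log b - Real.log a ≤ n * w := by
  have hn0 : (0 : ℝ) < n := by positivity
  have h1 : Real.log (natRoot n b / natRoot n a) ≤ natRoot n b / natRoot n a - 1 :=
    Real.log_le_sub_one_of_pos (div_pos (natRoot_pos _ _) (natRoot_pos _ _))
  rw [Real.log_div (natRoot_pos _ _).ne' (natRoot_pos _ _).ne', log_natRoot, log_natRoot,
    ← sub_div, div_le_iff₀ hn0] at h1
  have hw : 0 ≤ w := by linarith [ha.1, ha.2]
  have h2 : natRoot n b / natRoot n a - 1 ≤ w := by
    rw [sub_le_iff_le_add, div_le_iff₀ (natRoot_pos _ _)]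
    nlinarith [ha.1, hb.2]
  nlinarith

/-- Bounds for the integers whose `n`-th roots lie in a short interval. -/
theorem sum_inv_le_and_card_le_of_natRoot_mem {n : ℕ} {u w D Q : ℝ} (hn : 1 ≤ n) (hu : 1 ≤ u)
    (hw : 0 ≤ w) (hD : 0 ≤ D) (hQ : 0 ≤ Q) (M : Finset ℕ)
    (hM : ∀ m ∈ M, 1 ≤ m ∧ natRoot n m ∈ Icc u (u + w) ∧ 1 / ((n : ℝ) * m) ≤ D ∧
      (n : ℝ) * m ≤ Q) :
    ∑ m ∈ M, 1 / ((n : ℝ) * m) ≤ D + w ∧ (M.card : ℝ) ≤ 1 + w * Q := by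
  have hn0 : (0 : ℝ) < n := by positivity
  rcases M.eq_empty_or_nonempty with rfl | hne
  · simp only [Finset.sum_empty, Finset.card_empty, Nat.cast_zero]
    constructor <;> positivity
  obtain ⟨ha1, har, haD, -⟩ := hM _ (M.min'_mem hne)
  obtain ⟨hb1, hbr, -, hbQ⟩ := hM _ (M.max'_mem hne)
  have hab : M.min' hne ≤ M.max' hne := M.min'_le _ (M.max'_mem hne)
  have hsub : M ⊆ Finset.Icc (M.min' hne) (M.max' hne) := fun m hm =>
    Finset.mem_Icc.2 ⟨M.min'_le _ hm, M.le_max' _ hm⟩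
  set a := M.min' hne
  set b := M.max' hne
  have hlog := log_sub_log_le_of_natRoot_mem hn hu har hbr
  have ha0 : (0 : ℝ) < a := by positivity
  have hb0 : (0 : ℝ) < b := by positivity
  constructor
  -- The harmonic sum is a boundary term `1 / a` plus `log (b / a) ≤ n w`; after division by `n`
  -- these become `D` and `w`.
  · have h1 : ∑ m ∈ M, (1 : ℝ) / m ≤ 1 / a + n * w :=
      (Finset.sum_le_sum_of_subset_of_nonneg hsub fun _ _ _ => by positivity).trans
        ((sum_Icc_inv_le ha1 hab).trans (by linarith))
    have h2 : ∑ m ∈ M, 1 / ((n : ℝ) * m) = 1 / n * ∑ m ∈ M, (1 : ℝ) / m := by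
      rw [Finset.mul_sum]
      exact Finset.sum_congr rfl fun m _ => by rw [one_div_mul_one_div]
    rw [h2]
    calc 1 / (n : ℝ) * ∑ m ∈ M, (1 : ℝ) / m ≤ 1 / n * (1 / a + n * w) := by gcongr
      _ = 1 / (n * a) + w := by field_simp
      _ ≤ D + w := by linarith
  · have h1 := Finset.card_le_card hsub
    rw [Nat.card_Icc] at h1
    have h2 : (M.card : ℝ) ≤ b + 1 - a := by
      have : M.card + a ≤ b + 1 := by omega
      have : (M.card + a : ℝ) ≤ b + 1 := by exact_mod_cast this
      linarith
    have h3 := Real.one_sub_inv_le_log_of_pos (show (0 : ℝ) < b / a by positivity)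
    rw [Real.log_div hb0.ne' ha0.ne', inv_div] at h3
    have h4 : (1 - a / b : ℝ) * b ≤ n * w * b :=
      mul_le_mul_of_nonneg_right (h3.trans hlog) hb0.le
    rw [sub_mul, div_mul_cancel₀ _ hb0.ne'] at h4
    have h5 : w * (n * b) ≤ w * Q := mul_le_mul_of_nonneg_left hbQ hw
    linarith

/-- A bound for the number of exponents `n` for which some product `n * m` lies in a given range
while the `n`-th root of `m` lies in a given interval. -/
theorem card_le_of_natRoot_mem {ε u w X Y : ℝ} (hε : 0 < ε) (hε1 : ε ≤ 1) (hu : 1 + ε / 2 ≤ u)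
    (hw : 0 ≤ w) (hX : 0 < X) (hXY : X ≤ Y) (hY : 1 ≤ Y) (T : Finset ℕ)
    (hT : ∀ n ∈ T, 1 ≤ n ∧ ∃ m : ℕ, 1 ≤ m ∧ natRoot n m ∈ Icc u (u + w) ∧
      X ≤ (n : ℝ) * m ∧ (n : ℝ) * m ≤ Y) :
    (T.card : ℝ) ≤ 1 + (Real.log Y - Real.log X + 4 * w * Real.log Y / ε) * (4 / ε) := by
  have hlY := Real.log_nonneg hY
  have hlXY := Real.log_le_log hX hXY
  rcases T.eq_empty_or_nonempty with rfl | hne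
  · simp only [Finset.card_empty, Nat.cast_zero]
    have : 0 ≤ Real.log Y - Real.log X := by linarith
    positivity
  obtain ⟨ha1, k, hk, hak, haX, haY⟩ := hT _ (T.min'_mem hne)
  obtain ⟨hb1, m, hm, hbm, hbX, hbY⟩ := hT _ (T.max'_mem hne)
  have hab : T.min' hne ≤ T.max' hne := T.min'_le _ (T.max'_mem hne)
  have hsub : T ⊆ Finset.Icc (T.min' hne) (T.max' hne) := fun i hi =>
    Finset.mem_Icc.2 ⟨T.min'_le _ hi, T.le_max' _ hi⟩
  set a := T.min' hne
  set b := T.max' hne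
  have ha0 : (1 : ℝ) ≤ a := by exact_mod_cast ha1
  have hb0 : (1 : ℝ) ≤ b := by exact_mod_cast hb1
  have hab' : (a : ℝ) ≤ b := by exact_mod_cast hab
  have hk0 : (0 : ℝ) < k := by positivity
  have hm0 : (0 : ℝ) < m := by positivity
  have hεlog : ∀ p : ℝ, u ≤ p → ε / 4 ≤ Real.log p := by
    intro p hp
    have h1 := Real.one_sub_inv_le_log_of_pos (show 0 < p by linarith)
    have h2 : ε / 4 ≤ 1 - p⁻¹ := by
      rw [le_sub_comm, inv_le_iff_one_le_mul₀ (by linarith)]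
      nlinarith
    linarith
  have hla := hεlog _ hak.1
  have hlb := hεlog _ hbm.1
  have hka : Real.log k = a * Real.log (natRoot a k) := by
    rw [log_natRoot, mul_div_cancel₀ _ (by positivity)]
  have hmb : Real.log m = b * Real.log (natRoot b m) := by
    rw [log_natRoot, mul_div_cancel₀ _ (by positivity)]
  have h1 := Real.log_le_log hX haX
  have h2 := Real.log_le_log (by positivity) haY
  have h3 := Real.log_le_log (by positivity) hbY
  rw [Real.log_mul (by positivity) (by positivity)] at h1 h2 h3
  have hlogab : Real.log a ≤ Real.log b := Real.log_le_log (by linarith) hab'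
  have hloga : 0 ≤ Real.log a := Real.log_nonneg ha0
  have hdiff : Real.log (natRoot a k) - Real.log (natRoot b m) ≤ w := by
    have h4 : Real.log (natRoot a k / natRoot b m) ≤ natRoot a k / natRoot b m - 1 :=
      Real.log_le_sub_one_of_pos (div_pos (natRoot_pos _ _) (natRoot_pos _ _))
    rw [Real.log_div (natRoot_pos _ _).ne' (natRoot_pos _ _).ne'] at h4
    have h5 : natRoot a k / natRoot b m - 1 ≤ w := by
      rw [sub_le_iff_le_add, div_le_iff₀ (natRoot_pos _ _)]
      nlinarith [hak.2, hbm.1]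
    linarith
  have haw : (a : ℝ) * w ≤ 4 * w * Real.log Y / ε := by
    rw [le_div_iff₀ hε]
    have : (a : ℝ) * (ε / 4) ≤ Real.log Y :=
      (mul_le_mul_of_nonneg_left hla (by linarith)).trans (by linarith)
    nlinarith
  -- With `p_a`, `p_b` the two roots, `b log p_b - a log p_a ≤ log Y - log X`. Replacing `p_a` by
  -- `p_b` costs at most `a w`, and `a ≤ 4 log Y / ε`.
  have hmain : (b - a : ℝ) * (ε / 4) ≤
      Real.log Y - Real.log X + 4 * w * Real.log Y / ε := by
    have h6 : (b - a : ℝ) * (ε / 4) ≤ (b - a) * Real.log (natRoot b m) :=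
      mul_le_mul_of_nonneg_left hlb (by linarith)
    have h7 := mul_le_mul_of_nonneg_left hdiff (show (0 : ℝ) ≤ a by linarith)
    nlinarith
  have hcard : (T.card : ℝ) ≤ 1 + (b - a) := by
    have h8 := Finset.card_le_card hsub
    rw [Nat.card_Icc] at h8
    have : T.card + a ≤ b + 1 := by omega
    have : (T.card + a : ℝ) ≤ b + 1 := by exact_mod_cast this
    linarith
  have h9 : (b - a : ℝ) = (b - a) * (ε / 4) * (4 / ε) := by field_simp
  have h10 := mul_le_mul_of_nonneg_right hmain (show 0 ≤ 4 / ε by positivity)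
  linarith

/-- The intervals around the roots of `m`, for the pairs `(n, m)` in `W`, which contain the points
whose `n`-th power is within `η` of `m`, enlarged by `τ`. -/
def nearRoots (η τ : ℝ) (W : Finset (ℕ × ℕ)) : Set ℝ :=
  ⋃ q ∈ W, Metric.closedBall (natRoot q.1 q.2) (4 * η / (q.1 * q.2) + τ)

-- The first factor bounds the number of exponents, the second the total length of the balls for one
-- exponent.
open MeasureTheory in
theorem volume_inter_nearRoots_le {ε u w D X Y η τ : ℝ} (hε : 0 < ε) (hε1 : ε ≤ 1)
    (hu : 1 + ε / 2 ≤ u) (hw : 0 ≤ w) (hD : 0 ≤ D) (hX : 0 < X) (hXY : X ≤ Y) (hY : 1 ≤ Y)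
    (hη : 0 ≤ η) (hτ : 0 ≤ τ) (J : Set ℝ) (W : Finset (ℕ × ℕ))
    (hW : ∀ q ∈ W,
      (J ∩ Metric.closedBall (natRoot q.1 q.2) (4 * η / (q.1 * q.2) + τ)).Nonempty →
      1 ≤ q.1 ∧ 1 ≤ q.2 ∧ natRoot q.1 q.2 ∈ Icc u (u + w) ∧
      1 / ((q.1 : ℝ) * q.2) ≤ D ∧ X ≤ (q.1 : ℝ) * q.2 ∧ (q.1 : ℝ) * q.2 ≤ Y) :
    volume (J ∩ nearRoots η τ W) ≤ ENNReal.ofReal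
      ((1 + (Real.log Y - Real.log X + 4 * w * Real.log Y / ε) * (4 / ε)) *
        (8 * η * (D + w) + 2 * τ * (1 + w * Y))) := by
  classical
  set r : ℕ × ℕ → ℝ := fun q => 4 * η / (q.1 * q.2) + τ with hr
  have hr0 : ∀ q, 0 ≤ r q := fun q => by simp only [hr]; positivity
  set V := W.filter fun q => (J ∩ Metric.closedBall (natRoot q.1 q.2) (r q)).Nonempty with hV
  have hVW : ∀ q ∈ V, 1 ≤ q.1 ∧ 1 ≤ q.2 ∧ natRoot q.1 q.2 ∈ Icc u (u + w) ∧
      1 / ((q.1 : ℝ) * q.2) ≤ D ∧ X ≤ (q.1 : ℝ) * q.2 ∧ (q.1 : ℝ) * q.2 ≤ Y := fun q hq =>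
    hW q (Finset.mem_filter.1 hq).1 (Finset.mem_filter.1 hq).2
  have hsub : J ∩ nearRoots η τ W ⊆ ⋃ q ∈ V, Metric.closedBall (natRoot q.1 q.2) (r q) := by
    rintro x ⟨hxJ, hx⟩
    simp only [nearRoots, mem_iUnion] at hx ⊢
    obtain ⟨q, hq, hxq⟩ := hx
    exact ⟨q, Finset.mem_filter.2 ⟨hq, x, hxJ, hxq⟩, hxq⟩
  have hvol : volume (J ∩ nearRoots η τ W) ≤ ENNReal.ofReal (∑ q ∈ V, 2 * r q) := by
    refine (measure_mono hsub).trans ((measure_biUnion_finset_le _ _).trans ?_)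
    rw [ENNReal.ofReal_sum_of_nonneg fun q _ => by linarith [hr0 q]]
    exact Finset.sum_le_sum fun q _ => (Real.volume_closedBall _ _).le
  refine hvol.trans (ENNReal.ofReal_le_ofReal ?_)
  set C := 8 * η * (D + w) + 2 * τ * (1 + w * Y) with hC
  have hC0 : 0 ≤ C := by positivity
  have hfib : ∑ q ∈ V, 2 * r q =
      ∑ n ∈ V.image Prod.fst, ∑ q ∈ V.filter (fun q => q.1 = n), 2 * r q :=
    (Finset.sum_fiberwise_of_maps_to (fun q hq => Finset.mem_image_of_mem _ hq) _).symm
  have hone : ∀ n ∈ V.image Prod.fst, ∑ q ∈ V.filter (fun q => q.1 = n), 2 * r q ≤ C := by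
    intro n hn
    obtain ⟨q₀, hq₀, rfl⟩ := Finset.mem_image.1 hn
    set n := q₀.1
    set M := (V.filter fun q => q.1 = n).image Prod.snd with hM
    have hinj : Set.InjOn Prod.snd (V.filter fun q => q.1 = n : Set (ℕ × ℕ)) := by
      intro q hq q' hq' h
      simp only [Finset.coe_filter, mem_ofPred_eq] at hq hq'
      exact Prod.ext (hq.2.trans hq'.2.symm) h
    have hsum : ∑ q ∈ V.filter (fun q => q.1 = n), 2 * r q = ∑ m ∈ M, 2 * r (n, m) := by
      rw [hM, Finset.sum_image (by simpa using hinj)]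
      refine Finset.sum_congr rfl fun q hq => ?_
      rw [← (Finset.mem_filter.1 hq).2]
    obtain ⟨h1, h2⟩ := sum_inv_le_and_card_le_of_natRoot_mem (n := n) (u := u) (w := w) (D := D)
      (Q := Y) (hVW _ hq₀).1 (by linarith) hw hD (by linarith) M (by
        intro m hm
        obtain ⟨q, hq, rfl⟩ := Finset.mem_image.1 hm
        obtain ⟨hqV, hqn⟩ := Finset.mem_filter.1 hq
        have := hVW q hqV
        rw [hqn] at this
        exact ⟨this.2.1, this.2.2.1, this.2.2.2.1, this.2.2.2.2.2⟩)
    have h3 : ∑ m ∈ M, 2 * r (n, m) =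
        8 * η * ∑ m ∈ M, 1 / ((n : ℝ) * m) + 2 * τ * M.card := by
      rw [Finset.mul_sum, mul_comm (2 * τ), ← nsmul_eq_mul, ← Finset.sum_const,
        ← Finset.sum_add_distrib]
      exact Finset.sum_congr rfl fun m _ => by simp only [hr]; ring
    rw [hsum, h3, hC]
    gcongr
  have hcard := card_le_of_natRoot_mem hε hε1 hu hw hX hXY hY (V.image Prod.fst) (by
    intro n hn
    obtain ⟨q, hq, rfl⟩ := Finset.mem_image.1 hn
    have := hVW q hq
    exact ⟨this.1, q.2, this.2.1, this.2.2.1, this.2.2.2.2.1, this.2.2.2.2.2⟩)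
  rw [hfib]
  refine (Finset.sum_le_card_nsmul _ _ _ hone).trans ?_
  rw [nsmul_eq_mul]
  exact mul_le_mul_of_nonneg_right hcard hC0

/-! ### Windows and the main measure estimate -/

/-- The pairs `(n, m)` for which `n * m` lies between `ρ ^ (2 * k - 1)` and `ρ ^ (2 * k + 1)`. -/
def windowPairs (ρ k : ℕ) : Finset (ℕ × ℕ) :=
  (Finset.range (ρ ^ (2 * k + 1)) ×ˢ Finset.range (ρ ^ (2 * k + 1))).filter fun q =>
    1 ≤ q.1 ∧ 2 ≤ q.2 ∧ ρ ^ (2 * k) ≤ ρ * (q.1 * q.2) ∧ q.1 * q.2 < ρ ^ (2 * k + 1)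

theorem exists_mem_windowPairs {ρ n m : ℕ} (hρ : 2 ≤ ρ) (hn : 1 ≤ n) (hm : 2 ≤ m) :
    ∃ k, (n, m) ∈ windowPairs ρ k := by
  classical
  have hex : ∃ k, n * m < ρ ^ (2 * k + 1) :=
    ⟨n * m, (Nat.lt_pow_self (by omega : 1 < ρ)).trans_le
      (Nat.pow_le_pow_right (by omega) (by omega))⟩
  refine ⟨Nat.find hex, ?_⟩
  have h1 := Nat.find_spec hex
  have h2 : ρ ^ (2 * Nat.find hex) ≤ ρ * (n * m) := by
    rcases Nat.eq_zero_or_eq_succ_pred (Nat.find hex) with h | h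
    · rw [h]
      exact Nat.mul_pos (by omega) (Nat.mul_pos (by omega) (by omega))
    · have h3 := Nat.find_min hex (m := (Nat.find hex).pred) (by omega)
      rw [not_lt] at h3
      calc ρ ^ (2 * Nat.find hex) = ρ * ρ ^ (2 * (Nat.find hex).pred + 1) := by
            rw [← pow_succ']
            congr 1
            omega
        _ ≤ ρ * (n * m) := Nat.mul_le_mul_left _ h3
  simp only [windowPairs, Finset.mem_filter, Finset.mem_product, Finset.mem_range]
  exact ⟨⟨lt_of_le_of_lt (Nat.le_mul_of_pos_right _ (by omega)) h1,
    lt_of_le_of_lt (Nat.le_mul_of_pos_left _ (by omega)) h1⟩, hn, hm, h2, h1⟩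

/-- One exponent has at most `1 + 3ℓρ ^ (2k + 1)` roots nearby, so this is the total cost of
enlarging their balls by `τ`. The condition `ρε ≥ 2` absorbs the `1`. -/
theorem enlargement_le {ε : ℝ} {ρ j k : ℕ} (hε : 0 < ε) (hε1 : ε ≤ 1 / 4) (hρ : 2 / ε ≤ ρ)
    (hjk : k = j + 1 ∨ k = 0 ∧ j = 0) :
    2 * (ε / 2 / (ρ ^ 2 : ℝ) ^ (k + 1)) *
        (1 + 3 * (ε / 2 / (ρ ^ 2 : ℝ) ^ j) * ρ ^ (2 * k + 1)) ≤
      4 * ε / ρ * (ε / 2 / (ρ ^ 2 : ℝ) ^ j) ∧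
    ε / 2 / (ρ ^ 2 : ℝ) ^ (k + 1) ≤ ε / 2 / (ρ ^ 2 : ℝ) ^ j / 64 := by
  set ℓ := ε / 2 / (ρ ^ 2 : ℝ) ^ j with hℓ
  set τ := ε / 2 / (ρ ^ 2 : ℝ) ^ (k + 1) with hτ
  have hρ8 : (8 : ℝ) ≤ ρ := le_trans (by rw [le_div_iff₀ hε]; linarith) hρ
  have hερ : 2 ≤ ρ * ε := (div_le_iff₀ hε).1 hρ
  have hρ0 : (0 : ℝ) < ρ := by linarith
  have hτ0 : 0 < τ := by positivity
  have hρ2 : (64 : ℝ) ≤ ρ ^ 2 := by nlinarith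
  rcases hjk with rfl | ⟨rfl, rfl⟩
  · have h1 : ℓ = τ * ρ ^ 4 := by
      rw [hτ, hℓ]; field_simp; ring
    have h2 : ℓ * (ρ : ℝ) ^ (2 * (j + 1) + 1) = ε / 2 * ρ ^ 3 := by
      rw [hℓ]; field_simp; ring
    have h3 : 1 ≤ ε / 2 * (ρ : ℝ) ^ 3 := by
      have : ε / 2 * (ρ : ℝ) ^ 3 = ρ * ε / 2 * ρ ^ 2 := by ring
      rw [this]
      exact one_le_mul_of_one_le_of_one_le (by linarith) (by linarith)
    have h4 : (64 : ℝ) ≤ ρ ^ 4 := by nlinarith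
    constructor
    · have h5 : 4 * ε / ρ * ℓ = 2 * τ * (2 * ε * ρ ^ 3) := by
        rw [h1]; field_simp; ring
      rw [h5, mul_assoc 3, h2]
      exact mul_le_mul_of_nonneg_left (by linarith) (by positivity)
    · rw [h1]
      linarith [mul_le_mul_of_nonneg_left h4 hτ0.le]
  · have h1 : ℓ = τ * ρ ^ 2 := by
      rw [hτ, hℓ]; field_simp; simp
    have h2 : ℓ = ε / 2 := by rw [hℓ]; simp
    constructor
    · have h5 : 4 * ε / ρ * ℓ = 2 * τ * (2 * (ρ * ε)) := by
        rw [h1]; field_simp; ring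
      have h6 : 3 * ℓ * (ρ : ℝ) ^ (2 * 0 + 1) = 3 / 2 * (ρ * ε) := by rw [h2]; ring
      rw [h5, h6]
      exact mul_le_mul_of_nonneg_left (by linarith) (by positivity)
    · rw [h1]
      linarith [mul_le_mul_of_nonneg_left hρ2 hτ0.le]

/-- For `k = j + 1` the lower end of the window suffices. For `k = 0` it gives nothing useful;
instead a root of `m ≥ 2` below `1 + 2ε` forces `n ≥ 1 / (4ε)`. -/
theorem one_div_mul_le_of_mem_windowPairs {ε : ℝ} {ρ j k n m : ℕ} (hε : 0 < ε) (hε1 : ε ≤ 1 / 4)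
    (hρ : 2 / ε ≤ ρ) (hjk : k = j + 1 ∨ k = 0 ∧ j = 0) (hq : (n, m) ∈ windowPairs ρ k)
    (hp : natRoot n m ≤ 1 + 2 * ε) :
    1 / ((n : ℝ) * m) ≤ 4 * (ε / 2 / (ρ ^ 2 : ℝ) ^ j) := by
  obtain ⟨hn, hm, hX, -⟩ := (Finset.mem_filter.1 hq).2
  simp only at hn hm hX
  have hρ8 : (8 : ℝ) ≤ ρ := le_trans (by rw [le_div_iff₀ hε]; linarith) hρ
  have hερ : 2 ≤ ρ * ε := (div_le_iff₀ hε).1 hρ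
  have hρ0 : (0 : ℝ) < ρ := by linarith
  have hn1 : (1 : ℝ) ≤ n := by exact_mod_cast hn
  have hm2 : (2 : ℝ) ≤ m := by exact_mod_cast hm
  have hnm : (0 : ℝ) < n * m := by positivity
  have hX' : (ρ : ℝ) ^ (2 * k) ≤ ρ * (n * m) := by exact_mod_cast hX
  rcases hjk with rfl | ⟨rfl, rfl⟩
  · rw [div_le_iff₀ hnm]
    have h1 : (ρ ^ 2 : ℝ) ^ j * ρ ≤ n * m := by
      refine le_of_mul_le_mul_left (le_of_eq_of_le ?_ hX') hρ0
      ring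
    have h2 : 4 * (ε / 2 / (ρ ^ 2 : ℝ) ^ j) * ((ρ ^ 2 : ℝ) ^ j * ρ) = 2 * (ρ * ε) := by
      field_simp; ring
    have h3 := mul_le_mul_of_nonneg_left h1
      (show 0 ≤ 4 * (ε / 2 / (ρ ^ 2 : ℝ) ^ j) by positivity)
    linarith
  · have h1 := Real.log_le_sub_one_of_pos (natRoot_pos n m)
    rw [log_natRoot, div_le_iff₀ (by linarith)] at h1
    have h2 : Real.log 2 ≤ Real.log m := Real.log_le_log (by norm_num) hm2
    have h3 := Real.log_two_gt_d9
    have h4 : (natRoot n m - 1) * n ≤ 2 * ε * n :=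
      mul_le_mul_of_nonneg_right (by linarith) (by linarith)
    have h5 := mul_le_mul (show (1 / 2 : ℝ) ≤ 2 * ε * n by linarith) hm2 (by norm_num)
      (by positivity)
    rw [pow_zero, div_one, div_le_iff₀ hnm]
    linarith

open MeasureTheory in
/-- The estimate at level `j`, for the window `k`. The two relevant cases are `j = k = 0` and
`k = j + 1`. -/
theorem volume_inter_nearRoots_windowPairs_le {ε η a : ℝ} {ρ j k : ℕ} (hε : 0 < ε)
    (hε1 : ε ≤ 1 / 4) (hη : 0 ≤ η) (hηε : η ≤ ε / 32) (hρ : 2 / ε ≤ ρ)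
    (hjk : k = j + 1 ∨ k = 0 ∧ j = 0)
    (ha : 1 + 5 * ε / 4 ≤ a) (ha' : a + ε / 2 / (ρ ^ 2 : ℝ) ^ j ≤ 1 + 7 * ε / 4) :
    volume (Icc a (a + ε / 2 / (ρ ^ 2 : ℝ) ^ j) ∩
        nearRoots η (ε / 2 / (ρ ^ 2 : ℝ) ^ (k + 1)) (windowPairs ρ k)) ≤
      ENNReal.ofReal ((4536 * (η * Real.log ρ / ε) + 324 * (Real.log ρ / ρ)) *
        (ε / 2 / (ρ ^ 2 : ℝ) ^ j)) := by
  set ℓ := ε / 2 / (ρ ^ 2 : ℝ) ^ j with hℓ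
  set τ := ε / 2 / (ρ ^ 2 : ℝ) ^ (k + 1) with hτ
  have hρ8 : (8 : ℝ) ≤ ρ := le_trans (by rw [le_div_iff₀ hε]; linarith) hρ
  have hερ : 2 ≤ ρ * ε := (div_le_iff₀ hε).1 hρ
  have hρ0 : (0 : ℝ) < ρ := by linarith
  have hlρ : 1 ≤ Real.log ρ := by
    rw [Real.le_log_iff_exp_le hρ0]
    linarith [Real.exp_one_lt_d9]
  have hρj : (1 : ℝ) ≤ (ρ ^ 2 : ℝ) ^ j := one_le_pow₀ (by nlinarith)
  have hρk : (1 : ℝ) ≤ (ρ ^ 2 : ℝ) ^ k := one_le_pow₀ (by nlinarith)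
  have hℓ0 : 0 < ℓ := by positivity
  have hτ0 : 0 < τ := by positivity
  have hℓε : ℓ ≤ ε / 2 := div_le_self (by positivity) hρj
  have hτℓ := enlargement_le (j := j) (k := k) hε hε1 hρ hjk
  have hpow : (ρ : ℝ) ^ (2 * k) / ρ ≤ ρ ^ (2 * k + 1) := by
    rw [div_le_iff₀ hρ0, pow_succ]
    rw [mul_assoc]
    exact le_mul_of_one_le_right (by positivity) (by nlinarith)
  -- Balls meeting the interval have radius at most `ℓ`, so their centres lie in `[a - ℓ, a + 2ℓ]`.
  refine (volume_inter_nearRoots_le (ε := ε) (u := a - ℓ) (w := 3 * ℓ) (D := 4 * ℓ)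
    (X := ρ ^ (2 * k) / ρ) (Y := ρ ^ (2 * k + 1)) hε (by linarith) (by linarith) (by positivity)
    (by positivity) (by positivity) hpow (one_le_pow₀ (by linarith)) hη hτ0.le _ _ ?_).trans
    (ENNReal.ofReal_le_ofReal ?_)
  · rintro ⟨n, m⟩ hq ⟨x, hxJ, hx⟩
    obtain ⟨hn, hm, hX, hY⟩ := (Finset.mem_filter.1 hq).2
    simp only at hn hm hX hY hx ⊢
    rw [Real.closedBall_eq_Icc] at hx
    have hn1 : (1 : ℝ) ≤ n := by exact_mod_cast hn
    have hm2 : (2 : ℝ) ≤ m := by exact_mod_cast hm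
    have hnm : (0 : ℝ) < n * m := by positivity
    have hX' : (ρ : ℝ) ^ (2 * k) ≤ ρ * (n * m) := by exact_mod_cast hX
    have hY' : (n : ℝ) * m ≤ ρ ^ (2 * k + 1) := by exact_mod_cast hY.le
    have hη2 : 4 * η / (n * m) ≤ 2 * η := by
      rw [div_le_iff₀ hnm]
      nlinarith [mul_le_mul hn1 hm2 (by norm_num) (by linarith)]
    have hp2 : natRoot n m ≤ 1 + 2 * ε := by
      linarith [hx.1, hxJ.2]
    have hD : 1 / ((n : ℝ) * m) ≤ 4 * ℓ :=
      one_div_mul_le_of_mem_windowPairs hε hε1 hρ hjk hq hp2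
    have hr : 4 * η / (n * m) + τ ≤ ℓ := by
      have h1 : 4 * η / (n * m) = 4 * η * (1 / (n * m)) := by ring
      have h2 : 4 * η * (1 / (n * m)) ≤ 4 * η * (4 * ℓ) :=
        mul_le_mul_of_nonneg_left hD (by positivity)
      nlinarith [hτℓ.2]
    refine ⟨hn, by omega, ⟨?_, ?_⟩, hD, ?_, hY'⟩
    · linarith [hx.2, hxJ.1]
    · linarith [hx.1, hxJ.2]
    · rw [div_le_iff₀ hρ0]
      linarith
  · have hlY : Real.log ((ρ : ℝ) ^ (2 * k + 1)) = (2 * k + 1) * Real.log ρ := by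
      rw [Real.log_pow]; push_cast; ring
    have hlX : Real.log ((ρ : ℝ) ^ (2 * k) / ρ) = (2 * k - 1) * Real.log ρ := by
      rw [Real.log_div (by positivity) hρ0.ne', Real.log_pow]; push_cast; ring
    -- The logarithm of `Y` grows linearly in `k`, but `ℓ` decays geometrically.
    have hk : ℓ * (2 * k + 1) ≤ 3 * ε / 2 := by
      rcases hjk with rfl | ⟨rfl, rfl⟩
      · have h1 := one_add_mul_le_pow (show (-2 : ℝ) ≤ ρ ^ 2 - 1 by nlinarith) j
        rw [add_sub_cancel] at h1
        have h2 : (2 * (j + 1 : ℕ) + 1 : ℝ) ≤ 3 * (ρ ^ 2 : ℝ) ^ j := by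
          push_cast
          have : (0 : ℝ) ≤ j * (ρ ^ 2 - 2) := mul_nonneg j.cast_nonneg (by nlinarith)
          linarith
        calc ℓ * (2 * (j + 1 : ℕ) + 1) ≤ ℓ * (3 * (ρ ^ 2 : ℝ) ^ j) := by gcongr
          _ = 3 * ε / 2 := by rw [hℓ]; field_simp
      · push_cast
        linarith
    have hcount : 1 + (Real.log ((ρ : ℝ) ^ (2 * k + 1)) - Real.log ((ρ : ℝ) ^ (2 * k) / ρ) +
        4 * (3 * ℓ) * Real.log ((ρ : ℝ) ^ (2 * k + 1)) / ε) * (4 / ε) ≤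
        81 * Real.log ρ / ε := by
      rw [hlY, hlX]
      have h1 : 4 * (3 * ℓ) * ((2 * k + 1) * Real.log ρ) / ε ≤ 18 * Real.log ρ := by
        rw [div_le_iff₀ hε]
        nlinarith [mul_le_mul_of_nonneg_right hk (show 0 ≤ Real.log ρ by linarith)]
      have h2 : ((2 * k + 1) * Real.log ρ - (2 * k - 1) * Real.log ρ +
          4 * (3 * ℓ) * ((2 * k + 1) * Real.log ρ) / ε) * (4 / ε) ≤
          (20 * Real.log ρ) * (4 / ε) := by
        refine mul_le_mul_of_nonneg_right ?_ (by positivity)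
        linarith
      have h3 : 1 ≤ Real.log ρ / ε := by
        rw [le_div_iff₀ hε]
        linarith
      have h4 : (20 * Real.log ρ) * (4 / ε) = 80 * (Real.log ρ / ε) := by ring
      have h5 : 81 * Real.log ρ / ε = 81 * (Real.log ρ / ε) := by ring
      linarith
    have hsecond : 8 * η * (4 * ℓ + 3 * ℓ) + 2 * τ * (1 + 3 * ℓ * (ρ : ℝ) ^ (2 * k + 1)) ≤
        (56 * η + 4 * ε / ρ) * ℓ := by
      linarith [hτℓ.1]
    -- The constants are `4536 = 81 * 56` and `324 = 81 * 4`.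
    refine (mul_le_mul hcount hsecond (by positivity) (by positivity)).trans (le_of_eq ?_)
    field_simp
    ring

/-! ### The Cantor construction -/

open MeasureTheory in
/-- Admissible intervals at level `k`: they avoid the previous window, and the neighbourhoods
belonging to the window `k` cover only a small proportion of them. -/
def IsAdmissible (ε η : ℝ) (ρ k : ℕ) (a : ℝ) : Prop :=
  1 + 5 * ε / 4 ≤ a ∧ a + ε / 2 / (ρ ^ 2 : ℝ) ^ k ≤ 1 + 7 * ε / 4 ∧
    volume (Icc a (a + ε / 2 / (ρ ^ 2 : ℝ) ^ k) ∩
        nearRoots η (ε / 2 / (ρ ^ 2 : ℝ) ^ (k + 1)) (windowPairs ρ k)) ≤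
      ENNReal.ofReal (ε / 2 / (ρ ^ 2 : ℝ) ^ k / 8) ∧
    ∀ j, k = j + 1 → ∀ q ∈ windowPairs ρ j, ∀ x ∈ Icc a (a + ε / 2 / (ρ ^ 2 : ℝ) ^ k),
      η ≤ |x ^ q.1 - q.2|

theorem isAdmissible_zero {ε η : ℝ} {ρ : ℕ} (hε : 0 < ε) (hε1 : ε ≤ 1 / 4) (hη : 0 ≤ η)
    (hηε : η ≤ ε / 32) (hρ : 2 / ε ≤ ρ)
    (hsmall : 4536 * (η * Real.log ρ / ε) + 324 * (Real.log ρ / ρ) ≤ 1 / 64) :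
    IsAdmissible ε η ρ 0 (1 + 5 * ε / 4) := by
  have h1 : 1 + 5 * ε / 4 + ε / 2 / (ρ ^ 2 : ℝ) ^ 0 ≤ 1 + 7 * ε / 4 := by
    rw [pow_zero, div_one]; linarith
  refine ⟨le_rfl, h1, ?_, fun j hj => by omega⟩
  refine (volume_inter_nearRoots_windowPairs_le hε hε1 hη hηε hρ (Or.inr ⟨rfl, rfl⟩) le_rfl
    h1).trans (ENNReal.ofReal_le_ofReal ?_)
  have h2 : 0 < ε / 2 / (ρ ^ 2 : ℝ) ^ 0 := by rw [pow_zero, div_one]; linarith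
  linarith [mul_le_mul_of_nonneg_right hsmall h2.le]

theorem IsAdmissible.exists_finset {ε η a : ℝ} {M k : ℕ} (hε : 0 < ε) (hε1 : ε ≤ 1 / 4)
    (hη : 0 ≤ η) (hηε : η ≤ ε / 32) (hρ : 2 / ε ≤ (2 * M : ℕ))
    (hsmall : 4536 * (η * Real.log (2 * M : ℕ) / ε) +
      324 * (Real.log (2 * M : ℕ) / (2 * M : ℕ)) ≤ 1 / 64)
    (h : IsAdmissible ε η (2 * M) k a) :
    ∃ s : Finset ℕ, M ^ 2 ≤ s.card ∧ ∀ i ∈ s, 2 * i + 2 ≤ 4 * M ^ 2 ∧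
      IsAdmissible ε η (2 * M) (k + 1)
        (a + 2 * i * (ε / 2 / ((4 * M ^ 2 : ℕ) : ℝ) ^ (k + 1))) := by
  obtain ⟨ha, ha', hvol, -⟩ := h
  have hR : ((2 * M : ℕ) : ℝ) ^ 2 = (4 * M ^ 2 : ℕ) := by push_cast; ring
  have hM : 0 < M := by
    rcases Nat.eq_zero_or_pos M with rfl | h
    · have : 0 < 2 / ε := by positivity
      simp at hρ
      linarith
    · exact h
  have hV := volume_inter_nearRoots_windowPairs_le (j := k) (k := k + 1) hε hε1 hη hηε hρ
    (Or.inl rfl) ha ha'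
  rw [hR] at hvol hV ha'
  have hR0 : (0 : ℝ) < (4 * M ^ 2 : ℕ) := by positivity
  have hlen : ε / 2 / ((4 * M ^ 2 : ℕ) : ℝ) ^ k =
      (4 * M ^ 2 : ℕ) * (ε / 2 / ((4 * M ^ 2 : ℕ) : ℝ) ^ (k + 1)) := by
    field_simp; ring
  have hh : 0 < ε / 2 / ((4 * M ^ 2 : ℕ) : ℝ) ^ (k + 1) := by positivity
  rw [hlen] at hvol hV ha'
  obtain ⟨s, hs, hs'⟩ := exists_finset_not_subset_and_volume_le (N := M ^ 2) (by positivity) hh hvol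
    (hV.trans (ENNReal.ofReal_le_ofReal (by
      have := mul_le_mul_of_nonneg_right hsmall (mul_pos hR0 hh).le
      linarith)))
  refine ⟨s, hs, fun i hi => ?_⟩
  obtain ⟨h1, h2, h3⟩ := hs' i hi
  have hi2 : (2 * i + 2 : ℝ) ≤ (4 * M ^ 2 : ℕ) := by exact_mod_cast h1
  have h4 := mul_le_mul_of_nonneg_right hi2 hh.le
  have h5 : 0 ≤ 2 * (i : ℝ) * (ε / 2 / ((4 * M ^ 2 : ℕ) : ℝ) ^ (k + 1)) := by positivity
  refine ⟨h1, ?_⟩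
  unfold IsAdmissible
  rw [hR]
  refine ⟨by linarith, by linarith, h3, ?_⟩
  intro j hj q hq x hx
  obtain rfl : k = j := by omega
  by_contra! hlt
  -- The enlargement equals the subinterval's length, so one bad point would put the whole
  -- subinterval inside the enlarged neighbourhoods.
  refine h2 fun y hy => ?_
  obtain ⟨hn, hm, -, -⟩ := (Finset.mem_filter.1 hq).2
  have hxp := abs_sub_natRoot_le hn hm (by linarith [hx.1]) (by linarith [hx.2]) (by linarith) hlt
  simp only [nearRoots, mem_iUnion]
  refine ⟨q, hq, ?_⟩
  rw [Metric.mem_closedBall, Real.dist_eq]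
  have hxy : |y - x| ≤ ε / 2 / ((4 * M ^ 2 : ℕ) : ℝ) ^ (k + 1) := by
    rw [abs_le]
    constructor <;> linarith [hx.1, hx.2, hy.1, hy.2]
  have := abs_sub_le y x (natRoot q.1 q.2)
  linarith

theorem mem_awayFromIntegersSet_of_isAdmissible {ε η c x : ℝ} {ρ : ℕ} (hε : 0 < ε)
    (hηε : η ≤ ε) (hρ : 2 ≤ ρ) (hc : c * ε * |Real.log ε|⁻¹ < η)
    (hx : ∀ k, ∃ a, IsAdmissible ε η ρ k a ∧ x ∈ Icc a (a + ε / 2 / (ρ ^ 2 : ℝ) ^ k)) :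
    x - 1 ∈ awayFromIntegersSet ε c := by
  obtain ⟨a, ⟨ha, ha', -⟩, hxa⟩ := hx 0
  have hx1 : 1 + ε < x := by linarith [hxa.1]
  refine ⟨⟨by linarith, by linarith [hxa.2]⟩, hc.trans_le ?_⟩
  have : Nonempty {n : ℕ // 1 ≤ n} := ⟨⟨1, le_rfl⟩⟩
  refine le_ciInf fun ⟨n, hn⟩ => ?_
  simp only [distNearestInt, add_sub_cancel]
  generalize round (x ^ n) = z
  rcases le_or_gt z 1 with hz | hz
  -- Integers `z ≤ 1` need no window: `x ^ n ≥ x > 1 + ε`.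
  · have h1 : (z : ℝ) ≤ 1 := by exact_mod_cast hz
    have h2 : x ≤ x ^ n := le_self_pow₀ (by linarith) (by omega)
    exact le_trans (by linarith) (le_abs_self _)
  · lift z to ℕ using by omega
    obtain ⟨k, hk⟩ := exists_mem_windowPairs hρ hn (show 2 ≤ z by omega)
    obtain ⟨b, hb, hxb⟩ := hx (k + 1)
    simpa using hb.2.2.2 k rfl _ hk x hxb

theorem log_div_log_le_dimH_awayFromIntegersSet {ε η c : ℝ} {M : ℕ} (hε : 0 < ε)
    (hε1 : ε ≤ 1 / 4) (hη : 0 ≤ η) (hηε : η ≤ ε / 32) (hM : 2 ≤ M)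
    (hρ : 2 / ε ≤ (2 * M : ℕ))
    (hsmall : 4536 * (η * Real.log (2 * M : ℕ) / ε) +
      324 * (Real.log (2 * M : ℕ) / (2 * M : ℕ)) ≤ 1 / 64)
    (hc : c * ε * |Real.log ε|⁻¹ < η) :
    ENNReal.ofReal (Real.log (M ^ 2 : ℕ) / Real.log (4 * M ^ 2 : ℕ)) ≤
      dimH (awayFromIntegersSet ε c) := by
  refine (log_div_log_le_dimH_of_nested (by nlinarith) (half_pos hε) (IsAdmissible ε η (2 * M))
    (isAdmissible_zero hε hε1 hη hηε hρ hsmall)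
    fun k a h => h.exists_finset hε hε1 hη hηε hρ hsmall).trans ?_
  rw [← (IsometryEquiv.addRight (1 : ℝ)).dimH_image (awayFromIntegersSet ε c)]
  refine dimH_mono fun x hx => ⟨x - 1, ?_, by simp⟩
  have hR : ((2 * M : ℕ) : ℝ) ^ 2 = (4 * M ^ 2 : ℕ) := by push_cast; ring
  refine mem_awayFromIntegersSet_of_isAdmissible (η := η) (ρ := 2 * M) hε (by linarith) (by omega)
    hc ?_
  rw [hR]
  exact hx

/-! ### Choice of parameters -/

theorem log_le_two_mul_sqrt {y : ℝ} (hy : 0 < y) : Real.log y ≤ 2 * √y := by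
  have h1 := Real.log_le_sub_one_of_pos (Real.sqrt_pos.2 hy)
  rw [Real.log_sqrt hy.le] at h1
  linarith

/-- Take `M = ⌈1 / (cε)⌉`. The lower bounds on `2M` serve the dimension and the measure estimate;
the upper one keeps `log (2M)` comparable to `|log ε|` for fixed `c`. -/
theorem exists_nat_two_mul_bounds {ε c : ℝ} (hε : 0 < ε) (hε1 : ε ≤ 1) (hc : 0 < c)
    (hc1 : c ≤ 1 / 2) :
    ∃ M : ℕ, 2 ≤ M ∧ 1 / c ≤ 2 * M ∧ 2 / ε ≤ 2 * M ∧ (2 * M : ℝ) ≤ 4 * (1 / (c * ε)) := by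
  have hcε : 0 < c * ε := mul_pos hc hε
  have hcε1 : c * ε ≤ 1 / 2 := (mul_le_of_le_one_right hc.le hε1).trans hc1
  have h1 : 1 / c ≤ 1 / (c * ε) :=
    one_div_le_one_div_of_le hcε (mul_le_of_le_one_right hc.le hε1)
  have h2 : 1 / ε ≤ 1 / (c * ε) :=
    one_div_le_one_div_of_le hcε (mul_le_of_le_one_left hε.le (by linarith))
  have h3 : 2 ≤ 1 / (c * ε) := by rw [le_div_iff₀ hcε]; linarith
  have h4 : 1 / (c * ε) ≤ ⌈1 / (c * ε)⌉₊ := Nat.le_ceil _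
  have h5 := (Nat.ceil_lt_add_one (show 0 ≤ 1 / (c * ε) by positivity)).le
  have h6 : 2 / ε = 2 * (1 / ε) := by ring
  refine ⟨⌈1 / (c * ε)⌉₊, by exact_mod_cast h3.trans h4, ?_, ?_, ?_⟩ <;> linarith

theorem log_le_of_le_four_mul_one_div {ε c y : ℝ} (hε : 0 < ε) (hε1 : 1 ≤ Real.log (1 / ε))
    (hc : 0 < c) (hc1 : c ≤ 1 / 4) (hy : 0 < y) (hyc : y ≤ 4 * (1 / (c * ε))) :
    Real.log y ≤ (4 / √c + 1) * Real.log (1 / ε) := by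
  have h1 : y ≤ (1 / c) ^ 2 * (1 / ε) := by
    have h2 : (4 : ℝ) ≤ 1 / c := by rw [le_div_iff₀ hc]; linarith
    calc y ≤ 4 * (1 / (c * ε)) := hyc
      _ ≤ 1 / c * (1 / (c * ε)) := by gcongr
      _ = (1 / c) ^ 2 * (1 / ε) := by field_simp
  have h3 := Real.log_le_log hy h1
  rw [Real.log_mul (x := (1 / c) ^ 2) (by positivity) (by positivity), Real.log_pow] at h3
  have h4 := log_le_two_mul_sqrt (show 0 < 1 / c by positivity)
  rw [Real.sqrt_div zero_le_one, Real.sqrt_one] at h4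
  have h5 : 4 / √c ≤ 4 / √c * Real.log (1 / ε) := le_mul_of_one_le_right (by positivity) hε1
  have h6 : 2 * (2 * (1 / √c)) = 4 / √c := by ring
  push_cast at h3
  linarith

theorem log_div_le_two_mul_sqrt {c y : ℝ} (hc : 0 < c) (hy : 0 < y) (hcy : 1 / c ≤ y) :
    Real.log y / y ≤ 2 * √c := by
  have h2 : 1 ≤ √c * √y := by
    rw [← Real.sqrt_mul hc.le, Real.one_le_sqrt]
    rw [div_le_iff₀ hc] at hcy
    linarith
  rw [div_le_iff₀ hy]
  calc Real.log y ≤ 2 * √y * 1 := by linarith [log_le_two_mul_sqrt hy]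
    _ ≤ 2 * √y * (√c * √y) := by gcongr
    _ = 2 * √c * √y ^ 2 := by ring
    _ = 2 * √c * y := by rw [Real.sq_sqrt hy.le]

theorem one_sub_le_log_sq_div_log {δ : ℝ} {M : ℕ} (hδ : 0 < δ) (hM : 1 ≤ M)
    (h : Real.log 4 / δ ≤ Real.log (2 * M)) :
    1 - δ ≤ Real.log (M ^ 2 : ℕ) / Real.log (4 * M ^ 2 : ℕ) := by
  have hlog4 : 0 < Real.log 4 := Real.log_pos (by norm_num)
  have hM1 : (1 : ℝ) ≤ M := by exact_mod_cast hM
  have h1 : Real.log (4 * M ^ 2 : ℕ) = Real.log 4 + Real.log (M ^ 2 : ℕ) := by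
    push_cast
    rw [Real.log_mul (by norm_num) (by positivity)]
  have h2 : Real.log 4 / δ ≤ Real.log (4 * M ^ 2 : ℕ) := by
    refine h.trans (Real.log_le_log (by positivity) ?_)
    push_cast
    nlinarith
  have h3 : 0 < Real.log (4 * M ^ 2 : ℕ) := lt_of_lt_of_le (by positivity) h2
  rw [le_div_iff₀ h3]
  rw [div_le_iff₀ hδ] at h2
  linarith

/-- The lower bound for the dimension, with the range of `c` depending only on `δ`. -/
theorem one_sub_le_dimH_awayFromIntegersSet {δ ε c : ℝ} (hδ : 0 < δ)
    (hε : ε ∈ Ioo (0 : ℝ) (1 / 16))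
    (hc : c ∈ Ioo (0 : ℝ) (min ((1 / 10 ^ 7) ^ 2) (Real.exp (-(Real.log 4 / δ))))) :
    ENNReal.ofReal (1 - δ) ≤ dimH (awayFromIntegersSet ε c) := by
  obtain ⟨hε0, hε16⟩ := hε
  obtain ⟨hc0, hcm⟩ := hc
  have hc1 : c < (1 / 10 ^ 7) ^ 2 := hcm.trans_le (min_le_left _ _)
  have hc2 : Real.log 4 / δ ≤ Real.log (1 / c) := by
    have h := Real.log_le_log hc0 (hcm.le.trans (min_le_right _ _))
    rw [Real.log_exp] at h
    rw [one_div, Real.log_inv]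
    linarith
  have hs0 : 0 < √c := Real.sqrt_pos.2 hc0
  have hss : √c ^ 2 = c := Real.sq_sqrt hc0.le
  have hs7 : √c ≤ 1 / 10000000 := by
    rw [Real.sqrt_le_left (by norm_num)]
    exact hc1.le.trans (by norm_num)
  have hc64 : c ≤ 1 / 64 := hc1.le.trans (by norm_num)
  obtain ⟨M, hM2, hcM, hεM, hMle⟩ :=
    exists_nat_two_mul_bounds hε0 (by linarith) hc0 (by linarith)
  have hLlog : |Real.log ε| = Real.log (1 / ε) := by
    rw [abs_of_neg (Real.log_neg hε0 (by linarith)), one_div, Real.log_inv]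
  have hL1 : 1 ≤ Real.log (1 / ε) := by
    rw [Real.le_log_iff_exp_le (by positivity), le_div_iff₀ hε0]
    nlinarith [Real.exp_one_lt_d9]
  set L := Real.log (1 / ε)
  have hcε : 0 < c * ε := mul_pos hc0 hε0
  have hρcast : ((2 * M : ℕ) : ℝ) = 2 * M := by push_cast; ring
  have hρ0 : (0 : ℝ) < 2 * M := lt_of_lt_of_le (by positivity) hcM
  have hlogρ := log_le_of_le_four_mul_one_div hε0 hL1 hc0 (by linarith) hρ0 hMle
  have hlogdiv := log_div_le_two_mul_sqrt hc0 hρ0 hcM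
  have hLi0 : 0 < L⁻¹ := by positivity
  have hη0 : 0 < c * ε * L⁻¹ := mul_pos hcε hLi0
  have hηε : 2 * (c * ε * L⁻¹) ≤ ε / 32 := by
    have h1 : c * ε * L⁻¹ ≤ c * ε :=
      mul_le_of_le_one_right hcε.le (inv_le_one_of_one_le₀ hL1)
    have h2 := mul_le_mul_of_nonneg_right hc64 hε0.le
    linarith
  have hsmall : 2 * (c * ε * L⁻¹) * Real.log (2 * M) / ε ≤ 10 * √c := by
    calc 2 * (c * ε * L⁻¹) * Real.log (2 * M) / ε
        ≤ 2 * (c * ε * L⁻¹) * ((4 / √c + 1) * L) / ε := by gcongr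
      _ = 2 * c * (4 / √c + 1) := by field_simp
      _ = 2 * √c ^ 2 * (4 / √c + 1) := by rw [hss]
      _ = 8 * √c + 2 * √c ^ 2 := by field_simp; ring
      _ ≤ 10 * √c := by nlinarith
  -- The factor `2` in `η` provides the strict inequality. The bad proportion is at most `(4536 * 10
  -- + 324 * 2) √c`, below `1/64` since `√c ≤ 10⁻⁷`.
  have hdim := log_div_log_le_dimH_awayFromIntegersSet (η := 2 * (c * ε * L⁻¹)) (c := c) hε0
    (by linarith) (by linarith) hηε hM2 (by rw [hρcast]; exact hεM)
    (by rw [hρcast]; linarith) (by rw [hLlog]; linarith)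
  exact (ENNReal.ofReal_le_ofReal (one_sub_le_log_sq_div_log hδ (by omega)
    (hc2.trans (Real.log_le_log (by positivity) hcM)))).trans hdim

theorem mainTheorem4 :
    (∃ ε₀ : ℝ, 0 < ε₀ ∧ ∀ ε ∈ Ioo (0 : ℝ) ε₀,
      Tendsto (fun c : ℝ => dimH (awayFromIntegersSet ε c)) (𝓝[>] 0) (𝓝 1)) ∧
    (∀ δ : ℝ, 0 < δ → ∃ c₀ : ℝ, 0 < c₀ ∧ ∃ ε₁ : ℝ, 0 < ε₁ ∧
      ∀ ε ∈ Ioo (0 : ℝ) ε₁, ∀ c ∈ Ioo (0 : ℝ) c₀,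
        ENNReal.ofReal (1 - δ) ≤ dimH (awayFromIntegersSet ε c)) := by
  have hc₀ : ∀ δ : ℝ, (0 : ℝ) < min ((1 / 10 ^ 7) ^ 2) (Real.exp (-(Real.log 4 / δ))) := fun δ =>
    lt_min (by norm_num) (Real.exp_pos _)
  refine ⟨⟨1 / 16, by norm_num, fun ε hε => ?_⟩, fun δ hδ => ⟨_, hc₀ δ, 1 / 16, by norm_num,
    fun ε hε c hc => one_sub_le_dimH_awayFromIntegersSet hδ hε hc⟩⟩
  refine tendsto_order.2 ⟨fun b hb => ?_, fun b hb => ?_⟩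
  · have hbt : b ≠ ⊤ := hb.ne_top
    have hb1 : b.toReal < 1 := by
      rw [← ENNReal.toReal_one]
      exact (ENNReal.toReal_lt_toReal hbt ENNReal.one_ne_top).2 hb
    -- With this `δ`, `1 - δ` is the midpoint of `b` and `1`.
    filter_upwards [Ioo_mem_nhdsGT (hc₀ ((1 - b.toReal) / 2))] with c hc
    refine lt_of_lt_of_le ?_ (one_sub_le_dimH_awayFromIntegersSet (by linarith) hε hc)
    rw [ENNReal.lt_ofReal_iff_toReal_lt hbt]
    linarith
  · refine Eventually.of_forall fun c => lt_of_le_of_lt ?_ hb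
    exact (dimH_mono (subset_univ _)).trans Real.dimH_univ.le
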